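/- A coordination game (without bonuses) consists of a finite directed graph without self-loops on a vertex set $V$ (the players), a finite set $M$ of colours, a non-negative real weight $w_{u\to v}$ for every edge $u\to v$, and a non-empty set $C(v)\subseteq M$ of available colours (strategies) for every node $v$. A joint strategy $s$ assigns to every node $v$ a colour $s_v\in C(v)$, and the payoff of $v$ is $p_v(s)=\sum_{u\to v,\ s_u=s_v} w_{u\to v}$. A finite improvement path is a non-empty finite sequence of joint strategies in which each one arises from the previous one by changing the strategy of exactly one player and strictly increases that player's payoff, and which is maximal, that is, cannot be extended by a further such step (so its last element is a Nash equilibrium). Its length is the number of joint strategies in it. An open chain of $m\ge 2$ cycles is a directed graph that is the union of directed simple cycles $\mathcal C_j = (1^j\to 2^j\to\cdots\to \ell_j^{\,j}\to 1^j)$, $1\le j\le m$, with $\ell_j\ge 3$ nodes each, where for every $j<m$ the node $1^j$ is identified with some node $k^{j+1}$, $k\in\{2,\dots,\ell_{j+1}\}$, of the next cycle, and there are no other identifications and no other nodes or edges. Theorem. There is an absolute constant $K$ such that for all $m\ge 2$ and $n$, for every coordination game with arbitrary non-negative edge weights and without bonuses whose graph is an open chain of $m$ cycles, each with at least $3$ and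 at most $n$ nodes (in particular, when every cycle has exactly $n\ge 3$ nodes), and for every joint strategy $s^0$, there is a finite improvement path that starts at $s^0$ and has length at most $K\,n\,m^3$. -/

import Mathlib

/-- A strategic game: a set of strategies for each player and real payoffs on joint strategies. -/
structure StrategicGame (N : Type*) where
  Strategy : N → Type*
  payoff : N → (∀ i, Strategy i) → ℝ

namespace StrategicGame

/-- Joint strategies. -/
abbrev Joint {N : Type*} (G : StrategicGame N) := ∀ i, G.Strategy i

/-- `s'` is a deviation of the players in `K` from `s`: they are exactly the players whose
strategies differ. -/
def IsDeviation {N : Type*} (G : StrategicGame N) (K : Set N) (s s' : G.Joint) : Prop :=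
  K = {i | s i ≠ s' i}

/-- A deviation of the players in `K` is profitable if it increases the payoff of each of them. -/
def IsProfitableDeviation {N : Type*} (G : StrategicGame N) (K : Set N) (s s' : G.Joint) : Prop :=
  G.IsDeviation K s s' ∧ ∀ i ∈ K, G.payoff i s < G.payoff i s'

/-- One step of an improvement path: a profitable deviation of a single player. -/
def ImprovementStep {N : Type*} (G : StrategicGame N) (s s' : G.Joint) : Prop :=
  ∃ i, G.IsProfitableDeviation {i} s s'

/-- A finite improvement path: a nonempty finite sequence of joint strategies, each obtained from
the previous one by a profitable deviation of a single player, which is maximal, i.e. cannot be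
extended by a further such deviation. -/
structure IsFiniteImprovementPath {N : Type*} (G : StrategicGame N) (ρ : List G.Joint) : Prop where
  ne_nil : ρ ≠ []
  chain : ρ.IsChain G.ImprovementStep
  maximal : ∀ s' : G.Joint, ¬ (ρ ++ [s']).IsChain G.ImprovementStep

end StrategicGame

/-- The data of a coordination game without bonuses, with nodes `V` and colours `M`: a directed
graph without self-loops, a nonnegative weight for each edge (`weight u v` is the weight of
`u → v`; its value is irrelevant when there is no such edge), and a nonempty set of
available colours for each node. -/
structure CoordinationGame (V M : Type*) where
  graph : Digraph V
  loopless : ∀ v, ¬ graph.Adj v v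
  weight : V → V → ℝ
  weight_nonneg : ∀ u v, graph.Adj u v → 0 ≤ weight u v
  colours : V → Set M
  colours_nonempty : ∀ v, (colours v).Nonempty

open Classical in
/-- The strategic game of a coordination game: the players are the nodes, the strategies of a node
are its available colours, and the payoff of `v` is the total weight of the edges
`u → v` such that `u` has chosen the same colour as `v`. -/
noncomputable def CoordinationGame.toStrategicGame {V M : Type*} [Fintype V]
    (𝒢 : CoordinationGame V M) : StrategicGame V where
  Strategy v := 𝒢.colours v
  payoff v s := ∑ u with 𝒢.graph.Adj u v ∧ (s u : M) = (s v : M), 𝒢.weight u v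

/-- A presentation of the directed graph `G` as an open chain of `m` directed cycles, the `j`-th of
which has `len j ≥ 3` nodes `node j 0 → node j 1 → ⋯ → node j (len j - 1) → node j 0`.
The node `node j 0` of each cycle but the last is identified with a node of the next
cycle other than the distinguished node `node (j + 1) 0`; there are no other identifications
and no other nodes or edges. (`attach 0` plays no role.) -/
structure OpenChainOfCycles {V : Type*} (G : Digraph V) {m : ℕ} (len : Fin m → ℕ) where
  three_le_len : ∀ j, 3 ≤ len j
  node : (j : Fin m) → ZMod (len j) → V
  attach : (j : Fin m) → ZMod (len j)
  attach_ne_zero : ∀ j, attach j ≠ 0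
  exists_node : ∀ v, ∃ j i, node j i = v
  node_injective : ∀ j, Function.Injective (node j)
  node_eq_node_iff : ∀ j j' : Fin m, j < j' → ∀ (i : ZMod (len j)) (i' : ZMod (len j')),
    node j i = node j' i' ↔ (j : ℕ) + 1 = (j' : ℕ) ∧ i = 0 ∧ i' = attach j'
  adj_iff : ∀ u v, G.Adj u v ↔ ∃ j, ∃ i : ZMod (len j), u = node j i ∧ v = node j (i + 1)

/-! Call the nodes shared by two cycles hubs. Every other node has a single predecessor, so colours
are merely copied along the paths between hubs. The hubs form a line: each receives one colour from
the left and one from the right, and the two outer cycles lead from the end hubs back to themselves.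
A hub's move is bundled with a pass along its paths to neighbouring hubs, in all at most `2 * n + 1`
improvement steps; each path then either delivers the new colour or leaves its far end as it was.
`RelayChain` retains only this behaviour.

In a relay chain the prefix of best-responding nodes grows one node at a time, at linear cost. With
two nonnegative inputs, the present colour, the right input or the left input is always a best
response. When the new node moves, a wave may run down the prefix and return as new left inputs.
Each node moves at most twice in it: on the way down to a response that stays optimal unless copying
the left input is (`IsBest.exists_robust`), and on the way back by copying that input. The second
move returns to the left neighbour what that side has sent, so the neighbour still best-responds or
needs only one harmless correction (`RelayChain.Good`). A downward pass makes these corrections. If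
the new node ends the first wave dissatisfied, only its right input can be optimal, and a second
wave started with that colour succeeds.

The paths from an end hub to itself are frozen meanwhile and settled last: an input that turns into
a hub's own colour keeps its best response optimal. The total is of order `n * m ^ 2`, within the
claimed bound. -/

/-! ### Reachability with a bound on the number of steps. -/

/-- `ReachIn R n s t`: `t` can be reached from `s` in at most `n` steps of `R`. -/
inductive ReachIn {S : Type*} (R : S → S → Prop) : ℕ → S → S → Prop
  | refl (n : ℕ) (s : S) : ReachIn R n s s
  | step {n : ℕ} {s t u : S} : R s t → ReachIn R n t u → ReachIn R (n + 1) s u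

namespace ReachIn

variable {S : Type*} {R : S → S → Prop}

theorem mono {n m : ℕ} {s t : S} (h : ReachIn R n s t) (hnm : n ≤ m) : ReachIn R m s t := by
  induction h generalizing m with
  | refl n s => exact .refl m s
  | step hst _ ih =>
    obtain ⟨m, rfl⟩ : ∃ m', m = m' + 1 := ⟨m - 1, by omega⟩
    exact .step hst (ih (by omega))

theorem trans {n m : ℕ} {s t u : S} (h : ReachIn R n s t) (h' : ReachIn R m t u) :
    ReachIn R (n + m) s u := by
  induction h with
  | refl n s => exact h'.mono (by omega)
  | step hst _ ih => exact (ReachIn.step hst (ih h')).mono (by omega)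

theorem single {s t : S} (h : R s t) : ReachIn R 1 s t := .step h (.refl 0 t)

/-- A macro step that takes at most `c` steps, iterated. -/
theorem map {T : Type*} {Q : T → T → Prop} (f : S → T) (c : ℕ)
    (hf : ∀ s t, R s t → ReachIn Q c (f s) (f t)) {n : ℕ} {s t : S} (h : ReachIn R n s t) :
    ReachIn Q (n * c) (f s) (f t) := by
  induction h with
  | refl n s => exact .refl _ _
  | step hst _ ih => exact ((hf _ _ hst).trans ih).mono (by rw [Nat.add_mul]; omega)

end ReachIn

/-! ### Best responses to two inputs. -/

open Classical in
/-- The payoff of a node with colour `c` that has two predecessors with colours `l` and `r`. -/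
noncomputable def twoPay {M : Type*} (a b : ℝ) (l r c : M) : ℝ :=
  (if l = c then a else 0) + (if r = c then b else 0)

/-- `x` is a best response of a node with available colours `C` to its predecessors' colours. -/
def IsBest {M : Type*} (C : Set M) (a b : ℝ) (l r x : M) : Prop :=
  x ∈ C ∧ ∀ c ∈ C, twoPay a b l r c ≤ twoPay a b l r x

namespace IsBest

variable {M : Type*} {C : Set M} {a b : ℝ} {l r x : M}

theorem lt_of_not {f : M} (hf : IsBest C a b l r f) (hx : x ∈ C) (h : ¬ IsBest C a b l r x) :
    twoPay a b l r x < twoPay a b l r f := by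
  by_contra! hle
  exact h ⟨hx, fun c hc => (hf.2 c hc).trans hle⟩

/-- The change can only add `a` to the payoff of `x` and takes `a` away from any other colour that
had it. -/
theorem replace_left (ha : 0 ≤ a) (h : IsBest C a b l r x) : IsBest C a b x r x := by
  refine ⟨h.1, fun c hc => ?_⟩
  have := h.2 c hc
  simp only [twoPay] at *
  split_ifs at * <;> simp_all <;> linarith

theorem replace_right (hb : 0 ≤ b) (h : IsBest C a b l r x) : IsBest C a b l x x := by
  refine ⟨h.1, fun c hc => ?_⟩
  have := h.2 c hc
  simp only [twoPay] at *
  split_ifs at * <;> simp_all <;> linarith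

/-- Colours equal to neither input earn nothing, so only `l` competes with the available `r`. -/
theorem right_or_left (ha : 0 ≤ a) (hb : 0 ≤ b) (hr : r ∈ C) :
    IsBest C a b l r r ∨ IsBest C a b l r l := by
  by_cases hl : l ∈ C ∧ twoPay a b l r r ≤ twoPay a b l r l
  · refine Or.inr ⟨hl.1, fun c hc => ?_⟩
    by_cases h1 : l = c
    · rw [h1]
    by_cases h2 : r = c
    · rw [← h2]; exact hl.2
    · simp only [twoPay, h1, h2, if_true, if_false]
      split_ifs <;> linarith
  · refine Or.inl ⟨hr, fun c hc => ?_⟩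
    by_cases h2 : r = c
    · rw [← h2]
    by_cases h1 : l = c
    · subst h1
      exact (not_le.1 fun h => hl ⟨hc, h⟩).le
    · simp only [twoPay, h1, h2, if_true, if_false]
      split_ifs <;> linarith

/-- An unavailable right input never pays, so only the left one matters; if that is unavailable too,
all choices earn zero. -/
theorem self_or_left (ha : 0 ≤ a) (hr : r ∉ C) (hx : x ∈ C) :
    IsBest C a b l r x ∨ IsBest C a b l r l := by
  have key : ∀ c ∈ C, twoPay a b l r c = twoPay a 0 l r c := fun c hc => by
    have : r ≠ c := fun h => hr (h ▸ hc)
    simp [twoPay, this]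
  by_cases hl : l ∈ C
  · refine Or.inr ⟨hl, fun c hc => ?_⟩
    rw [key c hc, key l hl]
    simp only [twoPay]
    split_ifs <;> simp_all
  · refine Or.inl ⟨hx, fun c hc => ?_⟩
    have : l ≠ c := fun h => hl (h ▸ hc)
    rw [key c hc, key x hx]
    simp only [twoPay, this]
    split_ifs <;> simp_all

theorem exists_of_mem (ha : 0 ≤ a) (hb : 0 ≤ b) (hx : x ∈ C) :
    IsBest C a b l r x ∨ IsBest C a b l r r ∨ IsBest C a b l r l := by
  by_cases hr : r ∈ C
  · exact Or.inr (right_or_left ha hb hr)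
  · exact (self_or_left ha hr hx).imp_right Or.inr

/-- A node that was best-responding before its right input changed has a best response `f` to the
new inputs such that, however the left input changes afterwards, `f` or copying the left input is a
best response. -/
theorem exists_robust {r₀ : M} (ha : 0 ≤ a) (hb : 0 ≤ b) (h₀ : IsBest C a b l r₀ x)
    (h : ¬ IsBest C a b l r x) :
    ∃ f, IsBest C a b l r f ∧ ∀ l', IsBest C a b l' r f ∨ IsBest C a b l' r l' := by
  by_cases hr : r ∈ C
  · refine ⟨r, ?_, fun l' => right_or_left ha hb hr⟩
    rcases right_or_left (l := l) ha hb hr with hl | hl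
    · exact hl
    have h1 := hl.lt_of_not h₀.1 h
    have h2 := h₀.2 l hl.1
    by_cases hlr : l = r
    · exact hlr ▸ hl
    have hlx : l ≠ x := fun hlx => absurd h1 (by rw [hlx]; exact lt_irrefl _)
    -- Here `x` earns less than `a` now but earned at least `a` before, without matching `l`. Hence
    -- `r₀ = x` and `a ≤ b`, so copying `r` is as good as copying `l`.
    refine ⟨hr, fun c hc => (hl.2 c hc).trans ?_⟩
    simp only [twoPay, hlr, hlx, Ne.symm hlr, if_true, if_false] at h1 h2 ⊢
    split_ifs at * <;> linarith
  · have hl := (self_or_left (l := l) ha hr h₀.1).resolve_left h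
    exact ⟨l, hl, fun l' => self_or_left ha hr hl.1⟩

end IsBest

/-! ### Relay chains: reaching an equilibrium in quadratically many moves. -/

/-- A chain of `k` nodes, the `i`-th of which has the colour `x s i` and sees the colours `l s i`
and `r s i` on its left and right input. When it improves by switching to the colour `c`, this
colour may or may not get through to the left input of the next node and to the right input of the
previous one; nothing else changes. -/
structure RelayChain (S M : Type*) where
  k : ℕ
  x : S → ℕ → M
  l : S → ℕ → M
  r : S → ℕ → M
  C : ℕ → Set M
  a : ℕ → ℝ
  b : ℕ → ℝ
  a_nonneg : ∀ i, 0 ≤ a i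
  b_nonneg : ∀ i, 0 ≤ b i
  mem : ∀ s i, i < k → x s i ∈ C i
  Step : S → S → Prop
  exists_step : ∀ s i c, i < k → c ∈ C i →
    twoPay (a i) (b i) (l s i) (r s i) (x s i) < twoPay (a i) (b i) (l s i) (r s i) c →
    ∃ s', Step s s' ∧ x s' i = c ∧ (∀ j < k, j ≠ i → x s' j = x s j) ∧
      (∀ j < k, l s' j = l s j ∨ j = i + 1 ∧ l s' j = c) ∧
      (∀ j < k, r s' j = r s j ∨ j + 1 = i ∧ r s' j = c)

namespace RelayChain

variable {S M : Type*} (𝒮 : RelayChain S M)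

/-- The `i`-th node plays a best response. -/
def Best (s : S) (i : ℕ) : Prop :=
  IsBest (𝒮.C i) (𝒮.a i) (𝒮.b i) (𝒮.l s i) (𝒮.r s i) (𝒮.x s i)

/-- The `i`-th node plays a best response, or it can play one by copying its right input without
any effect on its neighbours' best responses. -/
def Good (s : S) (i : ℕ) : Prop :=
  𝒮.Best s i ∨ 𝒮.l s (i + 1) = 𝒮.r s i ∧
    IsBest (𝒮.C i) (𝒮.a i) (𝒮.b i) (𝒮.l s i) (𝒮.r s i) (𝒮.r s i) ∧
    ∀ h, h + 1 = i → IsBest (𝒮.C h) (𝒮.a h) (𝒮.b h) (𝒮.l s h) (𝒮.r s i) (𝒮.x s h)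

/-- What can happen to the input that the `i`-th node feeds while the nodes up to `i` adapt. -/
def Output (s s' : S) (i : ℕ) : Prop :=
  𝒮.l s' (i + 1) = 𝒮.l s (i + 1) ∨ 𝒮.l s' (i + 1) = 𝒮.x s' i ∨
    𝒮.x s' i = 𝒮.l s' i ∧ 𝒮.l s' (i + 1) ∈ 𝒮.C i ∧
    ∀ h, h + 1 = i → IsBest (𝒮.C h) (𝒮.a h) (𝒮.b h) (𝒮.l s' h) (𝒮.l s' (i + 1)) (𝒮.x s' h)

/-- Between `s` and `s'`, only nodes up to `i` have moved. -/
structure AgreeAbove (i : ℕ) (s s' : S) : Prop where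
  x : ∀ j < 𝒮.k, i < j → 𝒮.x s' j = 𝒮.x s j
  l : ∀ j < 𝒮.k, i + 1 < j → 𝒮.l s' j = 𝒮.l s j
  r : ∀ j < 𝒮.k, i ≤ j → 𝒮.r s' j = 𝒮.r s j

variable {𝒮}

theorem AgreeAbove.refl (i : ℕ) (s : S) : 𝒮.AgreeAbove i s s :=
  ⟨fun _ _ _ => rfl, fun _ _ _ => rfl, fun _ _ _ => rfl⟩

theorem AgreeAbove.trans {i : ℕ} {s t u : S} (h : 𝒮.AgreeAbove i s t) (h' : 𝒮.AgreeAbove i t u) :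
    𝒮.AgreeAbove i s u :=
  ⟨fun j hj hij => (h'.x j hj hij).trans (h.x j hj hij),
    fun j hj hij => (h'.l j hj hij).trans (h.l j hj hij),
    fun j hj hij => (h'.r j hj hij).trans (h.r j hj hij)⟩

theorem AgreeAbove.mono {i i' : ℕ} {s t : S} (h : 𝒮.AgreeAbove i s t) (hi : i ≤ i') :
    𝒮.AgreeAbove i' s t :=
  ⟨fun j hj hij => h.x j hj (by omega), fun j hj hij => h.l j hj (by omega),
    fun j hj hij => h.r j hj (by omega)⟩

theorem Best.congr {s s' : S} {i : ℕ} (h : 𝒮.Best s i) (hx : 𝒮.x s' i = 𝒮.x s i)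
    (hl : 𝒮.l s' i = 𝒮.l s i) (hr : 𝒮.r s' i = 𝒮.r s i) : 𝒮.Best s' i := by
  unfold Best
  rwa [hx, hl, hr]

theorem Good.congr {s s' : S} {i : ℕ} (h : 𝒮.Good s i) (hx : ∀ j ≤ i, 𝒮.x s' j = 𝒮.x s j)
    (hl : ∀ j ≤ i + 1, 𝒮.l s' j = 𝒮.l s j) (hr : 𝒮.r s' i = 𝒮.r s i) : 𝒮.Good s' i := by
  refine h.imp (fun h => h.congr (hx i le_rfl) (hl i (by omega)) hr) fun ⟨h1, h2, h3⟩ => ?_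
  refine ⟨by rw [hl _ le_rfl, hr, h1], by rwa [hl _ (by omega), hr], fun h hi => ?_⟩
  rw [hl _ (by omega), hr, hx _ (by omega)]
  exact h3 h hi

/-- A node moves to a best response. -/
theorem exists_move {s : S} {i : ℕ} {f : M} (hi : i < 𝒮.k) (h : ¬ 𝒮.Best s i)
    (hf : IsBest (𝒮.C i) (𝒮.a i) (𝒮.b i) (𝒮.l s i) (𝒮.r s i) f) :
    ∃ s', 𝒮.Step s s' ∧ 𝒮.x s' i = f ∧ 𝒮.Best s' i ∧ (∀ j < 𝒮.k, j ≠ i → 𝒮.x s' j = 𝒮.x s j) ∧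
      (∀ j < 𝒮.k, j ≠ i + 1 → 𝒮.l s' j = 𝒮.l s j) ∧
      (∀ j < 𝒮.k, j + 1 ≠ i → 𝒮.r s' j = 𝒮.r s j) ∧
      (i + 1 < 𝒮.k → 𝒮.l s' (i + 1) = 𝒮.l s (i + 1) ∨ 𝒮.l s' (i + 1) = f) ∧
      ∀ h, h + 1 = i → 𝒮.r s' h = 𝒮.r s h ∨ 𝒮.r s' h = f := by
  obtain ⟨s', h1, h2, h3, h4, h5⟩ := 𝒮.exists_step s i f hi hf.1 (hf.lt_of_not (𝒮.mem s i hi) h)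
  have hl : ∀ j < 𝒮.k, j ≠ i + 1 → 𝒮.l s' j = 𝒮.l s j := fun j hj hji =>
    (h4 j hj).resolve_right fun h => hji h.1
  have hr : ∀ j < 𝒮.k, j + 1 ≠ i → 𝒮.r s' j = 𝒮.r s j := fun j hj hji =>
    (h5 j hj).resolve_right fun h => hji h.1
  refine ⟨s', h1, h2, ?_, h3, hl, hr, fun hi' => (h4 _ hi').imp_right And.right,
    fun h hh => (h5 h (by omega)).imp_right And.right⟩
  unfold Best
  rwa [h2, hl i hi (by omega), hr i hi (by omega)]

/-- If the nodes below `i` have been best-responding to all inputs, and `i` to some right input,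
then they can adapt. -/
def Responds (𝒮 : RelayChain S M) (i : ℕ) : Prop :=
  ∀ (s : S) (r₀ : M), i < 𝒮.k → (∀ j < i, 𝒮.Best s j) →
    IsBest (𝒮.C i) (𝒮.a i) (𝒮.b i) (𝒮.l s i) r₀ (𝒮.x s i) →
    ∃ s', ReachIn 𝒮.Step (2 * (i + 1)) s s' ∧ 𝒮.AgreeAbove i s s' ∧ (∀ j < i, 𝒮.Good s' j) ∧
      𝒮.Best s' i ∧ (i + 1 < 𝒮.k → 𝒮.Output s s' i)

/-- After a move of the node `y` to a best response `f` the nodes below it adapt, and then it moves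
again if it wants to copy its left input. -/
theorem exists_adapt {s : S} {y : ℕ} {f : M} (ih : ∀ z, z + 1 = y → 𝒮.Responds z) (hy : y < 𝒮.k)
    (hs : ∀ j < y, 𝒮.Best s j) (hy' : ¬ 𝒮.Best s y)
    (hf : IsBest (𝒮.C y) (𝒮.a y) (𝒮.b y) (𝒮.l s y) (𝒮.r s y) f) :
    ∃ s', ReachIn 𝒮.Step (2 * (y + 1)) s s' ∧ 𝒮.AgreeAbove y s s' ∧ (∀ j < y, 𝒮.Good s' j) ∧
      (𝒮.Best s' y ∧ (y + 1 < 𝒮.k → 𝒮.Output s s' y) ∨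
        𝒮.x s' y = f ∧ ¬ 𝒮.Best s' y ∧
        ¬ IsBest (𝒮.C y) (𝒮.a y) (𝒮.b y) (𝒮.l s' y) (𝒮.r s' y) (𝒮.l s' y)) := by
  obtain ⟨s1, step1, x1, best1, ox1, ol1, or1, l1, r1⟩ := exists_move hy hy' hf
  have agree1 : 𝒮.AgreeAbove y s s1 :=
    ⟨fun j hj _ => ox1 j hj (by omega), fun j hj _ => ol1 j hj (by omega),
      fun j hj _ => or1 j hj (by omega)⟩
  have out1 : y + 1 < 𝒮.k → 𝒮.Output s s1 y := fun h => (l1 h).imp_right fun h => .inl (by rw [h, x1])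
  have below1 : ∀ j < y, j + 1 ≠ y → 𝒮.Best s1 j := fun j hj hjy =>
    (hs j hj).congr (ox1 j (by omega) (by omega)) (ol1 j (by omega) (by omega))
      (or1 j (by omega) hjy)
  obtain _ | z := y
  · exact ⟨s1, (ReachIn.single step1).mono (by omega), agree1, by simp, .inl ⟨best1, out1⟩⟩
  rcases r1 z rfl with rz | rz
  · refine ⟨s1, (ReachIn.single step1).mono (by omega), agree1, fun j hj => .inl ?_,
      .inl ⟨best1, out1⟩⟩
    rcases eq_or_ne j z with rfl | hjz
    · exact (hs j hj).congr (ox1 j (by omega) (by omega)) (ol1 j (by omega) (by omega)) rz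
    · exact below1 j hj (by omega)
  -- The colour `f` has reached the node below, which was best-responding to its right input in `s`;
  -- that input is the `r₀` of `Responds`.
  obtain ⟨s2, reach2, agree2, good2, best2, out2⟩ := ih z rfl s1 (𝒮.r s z) (by omega)
    (fun j hj => below1 j (by omega) (by omega)) (by
      rw [ox1 z (by omega) (by omega), ol1 z (by omega) (by omega)]
      exact hs z (by omega))
  replace out2 := out2 hy
  have x2 : 𝒮.x s2 (z + 1) = f := (agree2.x _ hy (by omega)).trans x1
  have r2 : 𝒮.r s2 (z + 1) = 𝒮.r s (z + 1) :=
    (agree2.r _ hy (by omega)).trans (or1 _ hy (by omega))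
  have rz2 : 𝒮.r s2 z = f := (agree2.r _ (by omega) le_rfl).trans rz
  have good2' : ∀ j < z + 1, 𝒮.Good s2 j := fun j hj => by
    rcases eq_or_ne j z with rfl | hjz
    · exact .inl best2
    · exact good2 j (by omega)
  have agree2' := agree1.trans (agree2.mono (Nat.le_succ z))
  have reach2' : ReachIn 𝒮.Step (2 * (z + 1) + 1) s s2 := .step step1 reach2
  have l2 : z + 1 + 1 < 𝒮.k → 𝒮.l s2 (z + 1 + 1) = 𝒮.l s (z + 1 + 1) ∨ 𝒮.l s2 (z + 1 + 1) = f :=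
    fun h => by rw [agree2.l _ h (by omega)]; exact l1 h
  by_cases hb : 𝒮.Best s2 (z + 1)
  · exact ⟨s2, reach2'.mono (by omega), agree2', good2', .inl ⟨hb, fun h =>
      (l2 h).imp_right fun h => .inl (by rw [h, x2])⟩⟩
  by_cases hl : IsBest (𝒮.C (z + 1)) (𝒮.a (z + 1)) (𝒮.b (z + 1)) (𝒮.l s2 (z + 1)) (𝒮.r s2 (z + 1))
      (𝒮.l s2 (z + 1))
  swap
  · exact ⟨s2, reach2'.mono (by omega), agree2', good2', .inr ⟨x2, hb, hl⟩⟩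
  obtain ⟨s3, step3, x3, best3, ox3, ol3, or3, l3, r3⟩ := exists_move hy hb hl
  have agree3 : 𝒮.AgreeAbove (z + 1) s2 s3 :=
    ⟨fun j hj _ => ox3 j hj (by omega), fun j hj _ => ol3 j hj (by omega),
      fun j hj _ => or3 j hj (by omega)⟩
  have xz3 := ox3 z (by omega) (by omega)
  have lz3 := ol3 z (by omega) (by omega)
  have ly3 := ol3 (z + 1) (by omega) (by omega)
  have bestz3 : IsBest (𝒮.C z) (𝒮.a z) (𝒮.b z) (𝒮.l s3 z) f (𝒮.x s3 z) := by
    rw [lz3, xz3, ← rz2]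
    exact best2
  refine ⟨s3, (reach2'.trans (.single step3)).mono (by omega), agree2'.trans agree3, ?_,
    .inl ⟨best3, fun h => ?_⟩⟩
  · intro j hj
    rcases eq_or_ne j z with rfl | hjz
    · rcases r3 j rfl with rj | rj
      · exact .inl (best2.congr xz3 lz3 rj)
      -- The node below now hears its own output. An unchanged output would have left `f` optimal.
      -- Its own colour, sent back, keeps it best-responding. In the stale case it copies its left
      -- input, so it is still best-responding or should copy the returned colour, which its output
      -- already carries: the second case of `Good`.
      rcases out2 with o | o | ⟨o1, o2, o3⟩
      · refine absurd ?_ hb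
        unfold Best
        rw [x2, r2, o, ol1 _ hy (by omega)]
        exact hf
      · refine .inl ?_
        unfold Best
        rw [rj, o, xz3, lz3]
        exact best2.replace_right (𝒮.b_nonneg _)
      · rcases IsBest.right_or_left (l := 𝒮.l s2 j) (𝒮.a_nonneg j) (𝒮.b_nonneg j) o2 with h | h
        · refine .inr ⟨by rw [ly3, rj], by rwa [lz3, rj], fun h hh => ?_⟩
          rw [rj, ol3 h (by omega) (by omega), ox3 h (by omega) (by omega)]
          exact o3 h hh
        · refine .inl ?_
          unfold Best
          rwa [rj, xz3, lz3, o1]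
    · exact (good2 j (by omega)).congr (fun i hi => ox3 i (by omega) (by omega))
        (fun i hi => ol3 i (by omega) (by omega)) (or3 j (by omega) (by omega))
  · rcases l3 h with h3 | h3
    · rcases l2 h with h2 | h2
      · exact .inl (h3.trans h2)
      -- The origin of the stale case of `Output`: the first colour `f` got through to the next node
      -- but the second did not. The node below, if still hearing `f`, would be best-responding,
      -- since it has adapted to `f`.
      · refine .inr (.inr ⟨x3.trans ly3.symm, ?_, ?_⟩)
        · rw [h3, h2]; exact hf.1
        · rintro w hw
          obtain rfl : w = z := by omega
          rw [h3, h2]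
          exact bestz3
    · exact .inr (.inl (h3.trans x3.symm))

/-- A robust first move rules out the failure case of `exists_adapt`, since the right input of `i`
stays fixed while the nodes below adapt. -/
theorem responds (i : ℕ) : 𝒮.Responds i := by
  induction i using Nat.strong_induction_on with
  | _ i ih =>
    intro s r₀ hi hs h₀
    by_cases hb : 𝒮.Best s i
    · exact ⟨s, .refl _ _, .refl _ _, fun j hj => .inl (hs j hj), hb, fun _ => .inl rfl⟩
    obtain ⟨f, hf, hf'⟩ := IsBest.exists_robust (𝒮.a_nonneg i) (𝒮.b_nonneg i) h₀ hb
    obtain ⟨s', h1, h2, h3, ⟨h4, h5⟩ | ⟨h4, h5, h6⟩⟩ :=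
      exists_adapt (fun z hz => ih z (by omega)) hi hs hb hf
    · exact ⟨s', h1, h2, h3, h4, h5⟩
    · unfold Best at h5
      rw [h4, h2.r i hi le_rfl] at h5
      rw [h2.r i hi le_rfl] at h6
      exact absurd (hf' _) (not_or.2 ⟨h5, h6⟩)

/-- A downward pass makes good nodes best-responding. -/
theorem exists_clean {y : ℕ} (hy : y < 𝒮.k) (i : ℕ) (hiy : i ≤ y) (s : S)
    (hs : ∀ j < i, 𝒮.Good s j) (hs' : ∀ j < y, i ≤ j → 𝒮.Best s j) :
    ∃ s', ReachIn 𝒮.Step i s s' ∧ (∀ j < y, 𝒮.Best s' j) ∧ 𝒮.x s' y = 𝒮.x s y ∧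
      𝒮.l s' y = 𝒮.l s y ∧ 𝒮.r s' y = 𝒮.r s y := by
  induction i generalizing s with
  | zero => exact ⟨s, .refl _ _, fun j hj => hs' j hj (by omega), rfl, rfl, rfl⟩
  | succ i ih =>
    by_cases hb : 𝒮.Best s i
    · obtain ⟨s', h1, h2⟩ := ih (by omega) s (fun j hj => hs j (by omega)) fun j hj hij => by
        rcases eq_or_ne j i with rfl | hji
        · exact hb
        · exact hs' j hj (by omega)
      exact ⟨s', h1.mono (by omega), h2⟩
    obtain ⟨hli, hri, hpred⟩ := (hs i (by omega)).resolve_left hb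
    obtain ⟨s1, step1, x1, best1, ox1, ol1, or1, l1, r1⟩ := exists_move (by omega) hb hri
    have hl : ∀ j < 𝒮.k, 𝒮.l s1 j = 𝒮.l s j := fun j hj => by
      rcases eq_or_ne j (i + 1) with rfl | hji
      -- The next node already receives the colour being copied.
      · exact (l1 hj).elim id fun h => h.trans hli.symm
      · exact ol1 j hj hji
    obtain ⟨s', h1, h2, h3, h4, h5⟩ := ih (by omega) s1 (fun j hj => by
      by_cases hji : j + 1 = i
      · rcases r1 j hji with rj | rj
        · exact (hs j (by omega)).congr (fun w hw => ox1 w (by omega) (by omega))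
            (fun w hw => hl w (by omega)) rj
        · refine .inl ?_
          unfold Best
          rw [rj, hl j (by omega), ox1 j (by omega) (by omega)]
          exact hpred j hji
      · exact (hs j (by omega)).congr (fun w hw => ox1 w (by omega) (by omega))
          (fun w hw => hl w (by omega)) (or1 j (by omega) hji)) (fun j hj hij => by
      rcases eq_or_ne j i with rfl | hji
      · exact best1
      · exact (hs' j hj (by omega)).congr (ox1 j (by omega) hji) (hl j (by omega))
          (or1 j (by omega) (by omega)))
    exact ⟨s', .step step1 h1, h2, h3.trans (ox1 y hy (by omega)), h4.trans (hl y hy),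
      h5.trans (or1 y hy (by omega))⟩

/-- Two waves of `2 * (y + 1)` moves, each followed by a downward pass of at most `y` moves,
suffice. No earlier right input is known for `y`, so its first move need not be robust. -/
theorem exists_extend {s : S} {y : ℕ} (hy : y < 𝒮.k) (hs : ∀ j < y, 𝒮.Best s j) :
    ∃ s', ReachIn 𝒮.Step (6 * (y + 1)) s s' ∧ ∀ j < y + 1, 𝒮.Best s' j := by
  have finish : ∀ {n : ℕ} {s₁ : S}, ReachIn 𝒮.Step n s s₁ → n + y ≤ 6 * (y + 1) →
      (∀ j < y, 𝒮.Good s₁ j) → 𝒮.Best s₁ y →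
      ∃ s', ReachIn 𝒮.Step (6 * (y + 1)) s s' ∧ ∀ j < y + 1, 𝒮.Best s' j := by
    intro n s₁ hreach hn hgood hbest
    obtain ⟨s', h1, h2, h3, h4, h5⟩ := exists_clean hy y le_rfl s₁ hgood fun j _ _ => by omega
    refine ⟨s', (hreach.trans h1).mono hn, fun j hj => ?_⟩
    rcases eq_or_ne j y with rfl | hjy
    · exact hbest.congr h3 h4 h5
    · exact h2 j (by omega)
  by_cases hb : 𝒮.Best s y
  · exact finish (.refl 0 s) (by omega) (fun j hj => .inl (hs j hj)) hb
  have ha := 𝒮.a_nonneg y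
  have hb' := 𝒮.b_nonneg y
  obtain ⟨f, hf⟩ : ∃ f, IsBest (𝒮.C y) (𝒮.a y) (𝒮.b y) (𝒮.l s y) (𝒮.r s y) f :=
    (IsBest.exists_of_mem ha hb' (𝒮.mem s y hy)).elim (fun h => ⟨_, h⟩)
      fun h => h.elim (fun h => ⟨_, h⟩) fun h => ⟨_, h⟩
  obtain ⟨s1, reach1, agree1, good1, ⟨h, -⟩ | ⟨-, h1, h2⟩⟩ :=
    exists_adapt (fun z _ => responds z) hy hs hb hf
  · exact finish reach1 (by omega) good1 h
  -- Neither staying nor copying the left input is optimal, so copying the right one is. That choice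
  -- is robust by `IsBest.right_or_left`.
  have h3 := ((IsBest.exists_of_mem ha hb' (𝒮.mem s1 y hy)).resolve_left h1).resolve_right h2
  obtain ⟨s2, reach2, best2, x2, l2, r2⟩ :=
    exists_clean hy y le_rfl s1 good1 fun j _ _ => by omega
  rw [← l2, ← r2] at h3
  obtain ⟨s3, reach3, agree3, good3, ⟨h, -⟩ | ⟨h4, h5, h6⟩⟩ :=
    exists_adapt (fun z _ => responds z) hy best2
      (fun h => h1 (h.congr x2.symm l2.symm r2.symm)) h3
  · exact finish ((reach1.trans reach2).trans reach3) (by omega) good3 h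
  · unfold Best at h5
    rw [h4, ← agree3.r y hy le_rfl] at h5
    have hmem : 𝒮.r s3 y ∈ 𝒮.C y := by rw [agree3.r y hy le_rfl]; exact h3.1
    exact absurd (IsBest.right_or_left ha hb' hmem) (not_or.2 ⟨h5, h6⟩)

/-- From every state, at most `6 k²` steps lead to one in which all nodes play best responses. -/
theorem exists_forall_best (s : S) :
    ∃ s', ReachIn 𝒮.Step (6 * 𝒮.k * 𝒮.k) s s' ∧ ∀ j < 𝒮.k, 𝒮.Best s' j := by
  have key : ∀ y ≤ 𝒮.k, ∃ s', ReachIn 𝒮.Step (6 * 𝒮.k * y) s s' ∧ ∀ j < y, 𝒮.Best s' j := by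
    intro y
    induction y with
    | zero => exact fun _ => ⟨s, .refl _ _, by simp⟩
    | succ y ih =>
      intro hy
      obtain ⟨s1, h1, h2⟩ := ih (by omega)
      obtain ⟨s2, h3, h4⟩ := exists_extend (by omega) h2
      exact ⟨s2, (h1.trans h3).mono (by nlinarith), h4⟩
  exact key _ le_rfl

end RelayChain

/-! ### Payoffs in coordination games and propagation along a path. -/

namespace CoordinationGame

variable {V M : Type*} (𝒢 : CoordinationGame V M)

/-- Joint strategies, with the available colours spelt out. -/
abbrev Coloring := ∀ v, 𝒢.colours v

variable {𝒢} in
/-- `v` gains nothing from the edge `u → v` by copying the colour of `u`. -/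
def Settled (s : 𝒢.Coloring) (u v : V) : Prop :=
  𝒢.weight u v = 0 ∨ (s u : M) = s v ∨ (s u : M) ∉ 𝒢.colours v

variable {𝒢} in
theorem Settled.congr {s s' : 𝒢.Coloring} {u v : V} (h : 𝒢.Settled s u v) (hu : s' u = s u)
    (hv : s' v = s v) : 𝒢.Settled s' u v := by
  unfold Settled
  rwa [hu, hv]

variable [Fintype V]

open Classical in
/-- The payoff of `v` if it switches to the colour `c`. -/
noncomputable def payWith (s : 𝒢.Coloring) (v : V) (c : M) : ℝ :=
  ∑ u with 𝒢.graph.Adj u v ∧ (s u : M) = c, 𝒢.weight u v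

/-- Improvement steps between joint strategies. -/
def Improves (s s' : 𝒢.Coloring) : Prop := 𝒢.toStrategicGame.ImprovementStep s s'

variable {𝒢}

theorem payoff_eq (s : 𝒢.Coloring) (v : V) :
    𝒢.toStrategicGame.payoff v s = 𝒢.payWith s v (s v) := rfl

theorem payWith_congr {s s' : 𝒢.Coloring} {v : V} (h : ∀ u, u ≠ v → s' u = s u) (c : M) :
    𝒢.payWith s' v c = 𝒢.payWith s v c := by
  classical
  unfold payWith
  congr 1
  ext u
  simp only [Finset.mem_filter, Finset.mem_univ, true_and]
  refine and_congr_right fun hu => ?_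
  rw [h u fun huv => 𝒢.loopless v (huv ▸ hu)]

open Classical in
theorem improves_update {s : 𝒢.Coloring} {v : V} {c : M} (hc : c ∈ 𝒢.colours v)
    (h : 𝒢.payWith s v (s v) < 𝒢.payWith s v c) :
    𝒢.Improves s (Function.update s v ⟨c, hc⟩) := by
  have hne : (s v : M) ≠ c := fun h' => h.ne (by rw [h'])
  refine ⟨v, ?_, ?_⟩
  · ext u
    simp only [Set.mem_singleton_iff, Set.mem_ofPred_eq]
    constructor
    · rintro rfl h'
      rw [Function.update_self] at h'
      exact hne (congrArg Subtype.val h')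
    · intro h'
      by_contra hu
      exact h' (Function.update_of_ne hu _ _).symm
  · rintro u rfl
    rw [payoff_eq, payoff_eq,
      payWith_congr (s' := Function.update s u ⟨c, hc⟩) fun w hw => Function.update_of_ne hw _ _]
    simpa using h

theorem Improves.exists_lt {s s' : 𝒢.Coloring} (h : 𝒢.Improves s s') :
    ∃ v, ∃ c ∈ 𝒢.colours v, 𝒢.payWith s v (s v) < 𝒢.payWith s v c := by
  obtain ⟨v, hv, h⟩ := h
  refine ⟨v, s' v, (s' v).2, ?_⟩
  have hlt := h v rfl
  rwa [payoff_eq, payoff_eq, payWith_congr (s := s) (s' := s')] at hlt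
  intro u hu
  by_contra hne
  have : u ∈ ({v} : Set V) := by
    rw [hv]
    exact fun h => hne h.symm
  exact hu this

open Classical in
theorem payWith_of_one {s : 𝒢.Coloring} {u v : V} (h : ∀ w, 𝒢.graph.Adj w v ↔ w = u) (c : M) :
    𝒢.payWith s v c = if (s u : M) = c then 𝒢.weight u v else 0 := by
  simp [payWith, Finset.sum_filter, h, ite_and]

theorem payWith_of_two {s : 𝒢.Coloring} {u u' v : V} (hne : u ≠ u')
    (h : ∀ w, 𝒢.graph.Adj w v ↔ w = u ∨ w = u') (c : M) :
    𝒢.payWith s v c = twoPay (M := M) (𝒢.weight u v) (𝒢.weight u' v) (s u) (s u') c := by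
  classical
  have hpred : Finset.univ.filter (𝒢.graph.Adj · v) = {u, u'} := by ext; simp [h]
  unfold payWith twoPay
  rw [← Finset.filter_filter, hpred, Finset.sum_filter, Finset.sum_pair hne]

theorem Settled.payWith_le {s : 𝒢.Coloring} {u v : V} (hs : 𝒢.Settled s u v)
    (h : ∀ w, 𝒢.graph.Adj w v ↔ w = u) {c : M} (hc : c ∈ 𝒢.colours v) :
    𝒢.payWith s v c ≤ 𝒢.payWith s v (s v) := by
  have hw := 𝒢.weight_nonneg u v ((h u).2 rfl)
  rw [payWith_of_one h, payWith_of_one h]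
  rcases hs with hs | hs | hs
  · simp [hs]
  · rw [if_pos hs]
    split_ifs <;> linarith
  · rw [if_neg fun h : (s u : M) = c => hs (h ▸ hc)]
    split_ifs <;> linarith

/-- One pass along a path whose inner nodes have no other predecessors. -/
theorem exists_settle (u : ℕ → V) (p : ℕ)
    (hadj : ∀ t < p, ∀ w, 𝒢.graph.Adj w (u (t + 1)) ↔ w = u t)
    (hinj : ∀ t < p, ∀ t' ≤ p, u t' = u (t + 1) → t' = t + 1) (s : 𝒢.Coloring) :
    ∃ s', ReachIn 𝒢.Improves p s s' ∧ (∀ v, (∀ t < p, v ≠ u (t + 1)) → s' v = s v) ∧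
      (∀ t < p, 𝒢.Settled s' (u t) (u (t + 1))) ∧
      ((∀ t < p, 0 < t → 𝒢.Settled s (u t) (u (t + 1))) →
        (s' (u p) : M) = s (u 0) ∨ s' (u p) = s (u p)) := by
  classical
  induction p with
  | zero => exact ⟨s, .refl _ _, fun _ _ => rfl, by simp, fun _ => .inr rfl⟩
  | succ p ih =>
    obtain ⟨s1, reach1, out1, set1, end1⟩ := ih (fun t ht => hadj t (by omega))
      fun t ht t' ht' => hinj t (by omega) t' (by omega)
    have hp1 : s1 (u (p + 1)) = s (u (p + 1)) := out1 _ fun t ht h => by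
      have := hinj t (by omega) (p + 1) le_rfl h
      omega
    by_cases hset : 𝒢.Settled s1 (u p) (u (p + 1))
    · refine ⟨s1, reach1.mono (by omega), fun v hv => out1 v fun t ht => hv t (by omega), ?_,
        fun _ => .inr hp1⟩
      intro t ht
      rcases eq_or_ne t p with rfl | htp
      · exact hset
      · exact set1 t (by omega)
    have hset' := hset
    simp only [Settled, not_or, not_not] at hset'
    obtain ⟨hw, hne, hc⟩ := hset'
    have hw' := 𝒢.weight_nonneg (u p) (u (p + 1)) ((hadj p (by omega) _).2 rfl)
    have himp := improves_update (s := s1) hc (by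
      rw [payWith_of_one (hadj p (by omega)), payWith_of_one (hadj p (by omega)), if_neg hne,
        if_pos rfl]
      exact lt_of_le_of_ne hw' (Ne.symm hw))
    have hout : ∀ v, v ≠ u (p + 1) →
        Function.update s1 (u (p + 1)) ⟨s1 (u p), hc⟩ v = s1 v := fun v hv =>
      Function.update_of_ne hv _ _
    have hpath : ∀ t ≤ p, Function.update s1 (u (p + 1)) ⟨s1 (u p), hc⟩ (u t) = s1 (u t) :=
      fun t ht => hout _ fun h => by
        have := hinj p (by omega) t (by omega) h
        omega
    refine ⟨_, reach1.trans (.single himp), fun v hv => ?_, fun t ht => ?_, fun htail => .inl ?_⟩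
    · rw [hout v (hv p (by omega))]
      exact out1 v fun t ht => hv t (by omega)
    · rcases eq_or_ne t p with rfl | htp
      · refine .inr (.inl ?_)
        rw [hpath t le_rfl, Function.update_self]
      · exact (set1 t (by omega)).congr (hpath t (by omega)) (hpath (t + 1) (by omega))
    · rw [Function.update_self]
      -- If the node before the end kept its colour, the last edge would still be settled unless it
      -- is also the first. So a change at the end was handed on all the way from `u 0`.
      refine (end1 fun t ht => htail t (by omega)).elim id fun h => ?_
      rcases Nat.eq_zero_or_pos p with rfl | hp
      · exact congrArg Subtype.val h
      · exact absurd ((htail p (by omega) hp).congr h hp1) hset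

end CoordinationGame

/-! ### Networks of hubs joined by paths. -/

namespace CoordinationGame

variable {V M : Type*}

/-- A presentation of the graph of a coordination game by `k` hubs, each of which has two
predecessors: the ends of two paths of nodes without further predecessors. The path `(false, i)`
leads to the hub `i` from the hub `i - 1` (from the hub `0` itself if `i = 0`), and the path
`(true, i)` leads there from the hub `i + 1` (from the hub `i` itself if `i = k - 1`). -/
structure RelayNetwork (𝒢 : CoordinationGame V M) where
  k : ℕ
  pos : 0 < k
  hub : ℕ → V
  path : Bool × ℕ → ℕ → V
  len : Bool × ℕ → ℕ
  path_zero_false : ∀ i < k, path (false, i) 0 = hub (i - 1)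
  path_zero_true : ∀ i < k, path (true, i) 0 = hub (min (i + 1) (k - 1))
  len_pos_false : 0 < len (false, 0)
  len_pos_true : 0 < len (true, k - 1)
  adj_path : ∀ d, d.2 < k → ∀ t < len d, ∀ u, 𝒢.graph.Adj u (path d (t + 1)) ↔ u = path d t
  adj_hub : ∀ i < k, ∀ u, 𝒢.graph.Adj u (hub i) ↔
    u = path (false, i) (len (false, i)) ∨ u = path (true, i) (len (true, i))
  ends_ne : ∀ i < k, path (false, i) (len (false, i)) ≠ path (true, i) (len (true, i))
  hub_inj : ∀ i < k, ∀ j < k, hub i = hub j → i = j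
  path_ne_hub : ∀ d, d.2 < k → ∀ t < len d, ∀ j < k, path d (t + 1) ≠ hub j
  path_inj : ∀ d, d.2 < k → ∀ t < len d, ∀ d', d'.2 < k → ∀ t' < len d',
    path d (t + 1) = path d' (t' + 1) → d = d' ∧ t = t'
  exhaust : ∀ v, (∃ i < k, v = hub i) ∨ ∃ d, d.2 < k ∧ ∃ t < len d, v = path d (t + 1)

namespace RelayNetwork

variable {𝒢 : CoordinationGame V M} (𝒩 : 𝒢.RelayNetwork)

/-- The index of the hub at which a path starts. -/
def src (d : Bool × ℕ) : ℕ := if d.1 then min (d.2 + 1) (𝒩.k - 1) else d.2 - 1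

theorem src_lt {d : Bool × ℕ} (hd : d.2 < 𝒩.k) : 𝒩.src d < 𝒩.k := by
  unfold src
  split_ifs <;> omega

theorem path_zero {d : Bool × ℕ} (hd : d.2 < 𝒩.k) : 𝒩.path d 0 = 𝒩.hub (𝒩.src d) := by
  obtain ⟨_ | _, i⟩ := d
  · simpa [src] using 𝒩.path_zero_false i hd
  · simpa [src] using 𝒩.path_zero_true i hd

theorem eq_of_src_eq {d : Bool × ℕ} (hd : d.2 < 𝒩.k) (h : 𝒩.src d = d.2) :
    d = (false, 0) ∨ d = (true, 𝒩.k - 1) := by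
  obtain ⟨_ | _, i⟩ := d <;> simp [src] at h hd ⊢ <;> omega

theorem len_pos {d : Bool × ℕ} (hd : d.2 < 𝒩.k) (h : 𝒩.src d = d.2) : 0 < 𝒩.len d := by
  obtain rfl | rfl := 𝒩.eq_of_src_eq hd h
  · exact 𝒩.len_pos_false
  · exact 𝒩.len_pos_true

/-- The paths starting at the hub `i` that lead to other hubs. -/
def outgoing (i : ℕ) : Finset (Bool × ℕ) :=
  -- At `i = 0` the truncated subtraction gives a candidate `(true, 0)` that the filter rejects.
  ({(false, i + 1), (true, i - 1)} : Finset (Bool × ℕ)).filter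
    fun d => d.2 < 𝒩.k ∧ 𝒩.src d = i ∧ 𝒩.src d ≠ d.2

theorem mem_outgoing {i : ℕ} {d : Bool × ℕ} :
    d ∈ 𝒩.outgoing i ↔ d.2 < 𝒩.k ∧ 𝒩.src d = i ∧ 𝒩.src d ≠ d.2 := by
  refine ⟨fun h => (Finset.mem_filter.1 h).2, fun h => Finset.mem_filter.2 ⟨?_, h⟩⟩
  obtain ⟨_ | _, j⟩ := d <;> simp [src] at h ⊢ <;> omega

theorem path_injOn {d : Bool × ℕ} (hd : d.2 < 𝒩.k) {t t' : ℕ} (ht : t < 𝒩.len d)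
    (ht' : t' ≤ 𝒩.len d) (h : 𝒩.path d t' = 𝒩.path d (t + 1)) : t' = t + 1 := by
  obtain _ | t' := t'
  · rw [𝒩.path_zero hd] at h
    exact absurd h.symm (𝒩.path_ne_hub d hd t ht _ (𝒩.src_lt hd))
  · rw [(𝒩.path_inj d hd t' (by omega) d hd t ht h).2]

theorem path_ne_of_ne {d d' : Bool × ℕ} (hd : d.2 < 𝒩.k) (hd' : d'.2 < 𝒩.k) (hne : d' ≠ d)
    {t t' : ℕ} (ht : t < 𝒩.len d) (ht' : t' ≤ 𝒩.len d') : 𝒩.path d' t' ≠ 𝒩.path d (t + 1) := by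
  intro h
  obtain _ | t' := t'
  · rw [𝒩.path_zero hd'] at h
    exact 𝒩.path_ne_hub d hd t ht _ (𝒩.src_lt hd') h.symm
  · exact hne (𝒩.path_inj d' hd' t' (by omega) d hd t ht h).1

/-- No node of the path `d` gains from copying its predecessor. -/
def SettledPath (s : 𝒢.Coloring) (d : Bool × ℕ) : Prop :=
  ∀ t < 𝒩.len d, 𝒢.Settled s (𝒩.path d t) (𝒩.path d (t + 1))

/-- No node of the path `d`, except perhaps the first one, gains from copying its predecessor. -/
def SettledTail (s : 𝒢.Coloring) (d : Bool × ℕ) : Prop :=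
  ∀ t < 𝒩.len d, 0 < t → 𝒢.Settled s (𝒩.path d t) (𝒩.path d (t + 1))

/-- The colour at the end of the path `d`. -/
def endColour (s : 𝒢.Coloring) (d : Bool × ℕ) : M := s (𝒩.path d (𝒩.len d))

variable {𝒩}

theorem SettledPath.tail {s : 𝒢.Coloring} {d : Bool × ℕ} (h : 𝒩.SettledPath s d) :
    𝒩.SettledTail s d := fun t ht _ => h t ht

theorem SettledPath.congr {s s' : 𝒢.Coloring} {d : Bool × ℕ} (h : 𝒩.SettledPath s d)
    (h' : ∀ t ≤ 𝒩.len d, s' (𝒩.path d t) = s (𝒩.path d t)) : 𝒩.SettledPath s' d :=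
  fun t ht => (h t ht).congr (h' t ht.le) (h' (t + 1) ht)

theorem SettledTail.congr {s s' : 𝒢.Coloring} {d : Bool × ℕ} (h : 𝒩.SettledTail s d)
    (h' : ∀ t ≤ 𝒩.len d, 0 < t → s' (𝒩.path d t) = s (𝒩.path d t)) : 𝒩.SettledTail s' d :=
  fun t ht ht0 => (h t ht ht0).congr (h' t ht.le ht0) (h' (t + 1) ht (by omega))

theorem endColour_congr {s s' : 𝒢.Coloring} {d : Bool × ℕ}
    (h' : ∀ t ≤ 𝒩.len d, s' (𝒩.path d t) = s (𝒩.path d t)) :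
    𝒩.endColour s' d = 𝒩.endColour s d := congrArg Subtype.val (h' _ le_rfl)

variable [Fintype V] {n : ℕ}

theorem exists_settlePath (hn : ∀ d, d.2 < 𝒩.k → 𝒩.len d ≤ n) {d : Bool × ℕ} (hd : d.2 < 𝒩.k)
    (s : 𝒢.Coloring) :
    ∃ s', ReachIn 𝒢.Improves n s s' ∧ (∀ i < 𝒩.k, s' (𝒩.hub i) = s (𝒩.hub i)) ∧
      (∀ d', d'.2 < 𝒩.k → d' ≠ d → ∀ t ≤ 𝒩.len d', s' (𝒩.path d' t) = s (𝒩.path d' t)) ∧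
      𝒩.SettledPath s' d ∧ (𝒩.SettledTail s d →
        𝒩.endColour s' d = s (𝒩.hub (𝒩.src d)) ∨ 𝒩.endColour s' d = 𝒩.endColour s d) := by
  obtain ⟨s', h1, h2, h3, h4⟩ := exists_settle (𝒩.path d) (𝒩.len d) (𝒩.adj_path d hd)
    (fun t ht t' ht' => 𝒩.path_injOn hd ht ht') s
  refine ⟨s', h1.mono (hn d hd), fun i hi => h2 _ fun t ht h => 𝒩.path_ne_hub d hd t ht i hi h.symm,
    fun d' hd' hne t' ht' => h2 _ fun t ht => 𝒩.path_ne_of_ne hd hd' hne ht ht', h3, fun h => ?_⟩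
  rw [← 𝒩.path_zero hd]
  exact (h4 h).imp_right (congrArg Subtype.val)

theorem exists_settlePaths (hn : ∀ d, d.2 < 𝒩.k → 𝒩.len d ≤ n) (D : Finset (Bool × ℕ))
    (hD : ∀ d ∈ D, d.2 < 𝒩.k) (s : 𝒢.Coloring) :
    ∃ s', ReachIn 𝒢.Improves (D.card * n) s s' ∧ (∀ i < 𝒩.k, s' (𝒩.hub i) = s (𝒩.hub i)) ∧
      (∀ d, d.2 < 𝒩.k → d ∉ D → ∀ t ≤ 𝒩.len d, s' (𝒩.path d t) = s (𝒩.path d t)) ∧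
      (∀ d ∈ D, 𝒩.SettledPath s' d) ∧ ∀ d ∈ D, 𝒩.SettledTail s d →
        𝒩.endColour s' d = s (𝒩.hub (𝒩.src d)) ∨ 𝒩.endColour s' d = 𝒩.endColour s d := by
  induction D using Finset.induction_on with
  | empty => exact ⟨s, .refl _ _, fun _ _ => rfl, fun _ _ _ _ _ => rfl, by simp, by simp⟩
  | insert d D hdD ih =>
    obtain ⟨s1, reach1, hub1, out1, set1, end1⟩ := ih fun d' hd' => hD d' (by simp [hd'])
    have hd : d.2 < 𝒩.k := hD d (by simp)
    obtain ⟨s2, reach2, hub2, out2, set2, end2⟩ := exists_settlePath hn hd s1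
    have hsame : ∀ d' ∈ D, ∀ t ≤ 𝒩.len d', s2 (𝒩.path d' t) = s1 (𝒩.path d' t) := fun d' hd' =>
      out2 d' (hD d' (by simp [hd'])) fun h => hdD (h ▸ hd')
    have hsrc := hub1 _ (𝒩.src_lt hd)
    refine ⟨s2, ?_, fun i hi => (hub2 i hi).trans (hub1 i hi), fun d' hd' hnot t ht => ?_, ?_, ?_⟩
    · rw [Finset.card_insert_of_notMem hdD, Nat.add_mul, one_mul]
      exact reach1.trans reach2
    · simp only [Finset.mem_insert, not_or] at hnot
      exact (out2 d' hd' hnot.1 t ht).trans (out1 d' hd' hnot.2 t ht)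
    · intro d' hd'
      rcases Finset.mem_insert.1 hd' with rfl | hd'
      · exact set2
      · exact (set1 d' hd').congr (hsame d' hd')
    · intro d' hd' htail
      rcases Finset.mem_insert.1 hd' with rfl | hd'
      · have hout := out1 d' hd hdD
        rw [← hsrc, ← endColour_congr hout]
        exact end2 (htail.congr fun t ht _ => hout t ht)
      · rw [endColour_congr (hsame d' hd')]
        exact end1 d' hd' htail

/-- The absolute values change nothing at a hub. They provide the nonnegativity that `RelayChain`
demands even at indices from `k` on, where no edge is given. -/
theorem payWith_hub (s : 𝒢.Coloring) {i : ℕ} (hi : i < 𝒩.k) (c : M) :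
    𝒢.payWith s (𝒩.hub i) c =
      twoPay |𝒢.weight (𝒩.path (false, i) (𝒩.len (false, i))) (𝒩.hub i)|
        |𝒢.weight (𝒩.path (true, i) (𝒩.len (true, i))) (𝒩.hub i)|
        (𝒩.endColour s (false, i)) (𝒩.endColour s (true, i)) c := by
  have hadj := 𝒩.adj_hub i hi
  rw [payWith_of_two (𝒩.ends_ne i hi) hadj,
    abs_of_nonneg (𝒢.weight_nonneg _ _ ((hadj _).2 (.inl rfl))),
    abs_of_nonneg (𝒢.weight_nonneg _ _ ((hadj _).2 (.inr rfl)))]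
  rfl

variable (𝒩) in
/-- The joint strategies in which all paths are settled, except that the first nodes of the two
paths that lead from a hub to itself need not be. -/
def Ready (s : 𝒢.Coloring) : Prop :=
  ∀ d, d.2 < 𝒩.k → 𝒩.SettledTail s d ∧ (𝒩.src d ≠ d.2 → 𝒩.SettledPath s d)

/-- One move of the hub and a pass along its at most two outgoing paths. Paths from the hub to
itself are left alone, so the outer inputs of the end hubs stay fixed. -/
theorem Ready.exists_step (hn : ∀ d, d.2 < 𝒩.k → 𝒩.len d ≤ n) {s : 𝒢.Coloring} (hs : 𝒩.Ready s)
    {i : ℕ} (hi : i < 𝒩.k) {c : M} (hc : c ∈ 𝒢.colours (𝒩.hub i))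
    (hlt : 𝒢.payWith s (𝒩.hub i) (s (𝒩.hub i)) < 𝒢.payWith s (𝒩.hub i) c) :
    ∃ s', ReachIn 𝒢.Improves (2 * n + 1) s s' ∧ 𝒩.Ready s' ∧ (s' (𝒩.hub i) : M) = c ∧
      (∀ j < 𝒩.k, j ≠ i → s' (𝒩.hub j) = s (𝒩.hub j)) ∧
      ∀ d, d.2 < 𝒩.k → 𝒩.endColour s' d = 𝒩.endColour s d ∨
        d ∈ 𝒩.outgoing i ∧ 𝒩.endColour s' d = c := by
  classical
  set s1 : 𝒢.Coloring := Function.update s (𝒩.hub i) ⟨c, hc⟩ with hs1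
  have himp : 𝒢.Improves s s1 := improves_update hc hlt
  have hself : (s1 (𝒩.hub i) : M) = c := by rw [hs1, Function.update_self]
  have hhub : ∀ j < 𝒩.k, j ≠ i → s1 (𝒩.hub j) = s (𝒩.hub j) := fun j hj hji =>
    Function.update_of_ne (fun h => hji (𝒩.hub_inj j hj i hi h)) _ _
  have hpath : ∀ d, d.2 < 𝒩.k → ∀ t ≤ 𝒩.len d, (t = 0 → 𝒩.src d ≠ i) →
      s1 (𝒩.path d t) = s (𝒩.path d t) := by
    intro d hd t ht ht0
    obtain _ | t := t
    · rw [𝒩.path_zero hd]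
      exact hhub _ (𝒩.src_lt hd) (ht0 rfl)
    · exact Function.update_of_ne (𝒩.path_ne_hub d hd t ht i hi) _ _
  have htail : ∀ d, d.2 < 𝒩.k → 𝒩.SettledTail s1 d := fun d hd =>
    (hs d hd).1.congr fun t ht ht0 => hpath d hd t ht (by omega)
  obtain ⟨s', reach, hub', out', set', end'⟩ := exists_settlePaths hn (𝒩.outgoing i)
    (fun d hd => (𝒩.mem_outgoing.1 hd).1) s1
  refine ⟨s', ?_, fun d hd => ?_, ?_, fun j hj hji => (hub' j hj).trans (hhub j hj hji),
    fun d hd => ?_⟩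
  · have hcard : (𝒩.outgoing i).card ≤ 2 :=
      (Finset.card_filter_le _ _).trans Finset.card_le_two
    exact (ReachIn.step himp reach).mono
      (Nat.add_le_add_right (Nat.mul_le_mul_right n hcard) 1)
  · by_cases hdi : d ∈ 𝒩.outgoing i
    · exact ⟨(set' d hdi).tail, fun _ => set' d hdi⟩
    · refine ⟨(htail d hd).congr fun t ht _ => out' d hd hdi t ht, fun hsrc => ?_⟩
      exact ((hs d hd).2 hsrc).congr fun t ht => (out' d hd hdi t ht).trans
        (hpath d hd t ht fun _ h => hdi (𝒩.mem_outgoing.2 ⟨hd, h, hsrc⟩))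
  · rw [hub' i hi, hself]
  · have key : 𝒩.len d ≠ 0 ∨ 𝒩.src d ≠ i → 𝒩.endColour s1 d = 𝒩.endColour s d := fun h =>
      congrArg Subtype.val (hpath d hd _ le_rfl fun h0 => h.resolve_left (not_not.2 h0))
    by_cases hdi : d ∈ 𝒩.outgoing i
    · have hsrc := (𝒩.mem_outgoing.1 hdi).2.1
      rcases end' d hdi (htail d hd) with h | h
      · exact .inr ⟨hdi, by rw [h, hsrc, hself]⟩
      · by_cases h0 : 𝒩.len d = 0
        · refine .inr ⟨hdi, ?_⟩
          rw [h, endColour, h0, 𝒩.path_zero hd, hsrc, hself]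
        · exact .inl (h.trans (key (.inl h0)))
    · refine .inl ((endColour_congr (out' d hd hdi)).trans (key ?_))
      -- The hub's own move changes an end colour only on a path of length zero; such a path is no
      -- loop, hence is outgoing.
      by_contra! h
      have : 𝒩.src d = d.2 := by
        by_contra hsrc
        exact hdi (𝒩.mem_outgoing.2 ⟨hd, h.2, hsrc⟩)
      exact (𝒩.len_pos hd this).ne' h.1

variable (𝒩) in
/-- The hubs of a network, in the joint strategies that are `Ready`. -/
noncomputable def toRelayChain (hn : ∀ d, d.2 < 𝒩.k → 𝒩.len d ≤ n) :
    RelayChain {s : 𝒢.Coloring // 𝒩.Ready s} M where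
  k := 𝒩.k
  x s i := s.1 (𝒩.hub i)
  l s i := 𝒩.endColour s.1 (false, i)
  r s i := 𝒩.endColour s.1 (true, i)
  C i := 𝒢.colours (𝒩.hub i)
  a i := |𝒢.weight (𝒩.path (false, i) (𝒩.len (false, i))) (𝒩.hub i)|
  b i := |𝒢.weight (𝒩.path (true, i) (𝒩.len (true, i))) (𝒩.hub i)|
  a_nonneg _ := abs_nonneg _
  b_nonneg _ := abs_nonneg _
  mem s i _ := (s.1 (𝒩.hub i)).2
  Step s s' := ReachIn 𝒢.Improves (2 * n + 1) s.1 s'.1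
  exists_step s i c hi hc hlt := by
    rw [← payWith_hub s.1 hi, ← payWith_hub s.1 hi] at hlt
    obtain ⟨s', h1, h2, h3, h4, h5⟩ := s.2.exists_step hn hi hc hlt
    refine ⟨⟨s', h2⟩, h1, h3, fun j hj hji => congrArg Subtype.val (h4 j hj hji),
      fun j hj => (h5 (false, j) hj).imp_right fun h => ⟨?_, h.2⟩,
      fun j hj => (h5 (true, j) hj).imp_right fun h => ⟨?_, h.2⟩⟩
    · have := 𝒩.mem_outgoing.1 h.1
      simp [src] at this
      omega
    · have := 𝒩.mem_outgoing.1 h.1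
      simp [src] at this
      omega

/-- From every joint strategy, polynomially many improvement steps lead to a Nash equilibrium. -/
theorem exists_nash (hn : ∀ d, d.2 < 𝒩.k → 𝒩.len d ≤ n) (s : 𝒢.Coloring) :
    ∃ s', ReachIn 𝒢.Improves (2 * 𝒩.k * n + 6 * 𝒩.k * 𝒩.k * (2 * n + 1) + 2 * n) s s' ∧
      ∀ s'', ¬ 𝒢.Improves s' s'' := by
  obtain ⟨s1, reach1, -, -, set1, -⟩ := exists_settlePaths hn
    (Finset.univ ×ˢ Finset.range 𝒩.k) (by simp) s
  have ready1 : 𝒩.Ready s1 := fun d hd =>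
    have h := set1 d (by simpa using hd)
    ⟨h.tail, fun _ => h⟩
  obtain ⟨⟨s2, ready2⟩, reach2, best2⟩ :=
    (𝒩.toRelayChain hn).exists_forall_best ⟨s1, ready1⟩
  replace reach2 := reach2.map (Q := 𝒢.Improves) Subtype.val (2 * n + 1) fun _ _ h => h
  have hpos := 𝒩.pos
  -- The frozen loops are released: each returns its hub's own colour or its old end colour, and
  -- both keep the hubs best-responding.
  obtain ⟨s3, reach3, hub3, out3, set3, end3⟩ := exists_settlePaths hn
    {(false, 0), (true, 𝒩.k - 1)} (by simp; omega) s2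
  refine ⟨s3, ((reach1.trans reach2).trans reach3).mono ?_, fun s'' himp => ?_⟩
  · have h1 : (Finset.univ ×ˢ Finset.range 𝒩.k : Finset (Bool × ℕ)).card = 2 * 𝒩.k := by simp
    have h2 : ({(false, 0), (true, 𝒩.k - 1)} : Finset (Bool × ℕ)).card ≤ 2 := Finset.card_le_two
    rw [h1]
    exact Nat.add_le_add_left (Nat.mul_le_mul_right n h2) _
  have settled : ∀ d, d.2 < 𝒩.k → 𝒩.SettledPath s3 d := fun d hd => by
    by_cases hmem : d ∈ ({(false, 0), (true, 𝒩.k - 1)} : Finset (Bool × ℕ))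
    · exact set3 d hmem
    · refine ((ready2 d hd).2 fun h => hmem ?_).congr (out3 d hd hmem)
      simpa using 𝒩.eq_of_src_eq hd h
  have hend : ∀ d, d.2 < 𝒩.k → 𝒩.endColour s3 d = s2 (𝒩.hub d.2) ∨
      𝒩.endColour s3 d = 𝒩.endColour s2 d := fun d hd => by
    by_cases hmem : d ∈ ({(false, 0), (true, 𝒩.k - 1)} : Finset (Bool × ℕ))
    · have hsrc : 𝒩.src d = d.2 := by
        simp only [Finset.mem_insert, Finset.mem_singleton] at hmem
        rcases hmem with rfl | rfl <;> simp [src]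
      rw [← hsrc]
      exact end3 d hmem (ready2 d hd).1
    · exact .inr (endColour_congr (out3 d hd hmem))
  obtain ⟨v, c, hc, hlt⟩ := himp.exists_lt
  rcases 𝒩.exhaust v with ⟨i, hi, rfl⟩ | ⟨d, hd, t, ht, rfl⟩
  · rw [payWith_hub s3 hi, payWith_hub s3 hi, hub3 i hi] at hlt
    have hbest := best2 i hi
    simp only [RelayChain.Best, toRelayChain] at hbest
    rcases hend (false, i) hi with hl | hl <;> rcases hend (true, i) hi with hr | hr <;>
      rw [hl, hr] at hlt
    · exact absurd hlt (not_lt.2 (((hbest.replace_left (abs_nonneg _)).replace_right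
        (abs_nonneg _)).2 c hc))
    · exact absurd hlt (not_lt.2 ((hbest.replace_left (abs_nonneg _)).2 c hc))
    · exact absurd hlt (not_lt.2 ((hbest.replace_right (abs_nonneg _)).2 c hc))
    · exact absurd hlt (not_lt.2 (hbest.2 c hc))
  · exact absurd hlt (not_lt.2 ((settled d hd t ht).payWith_le (𝒩.adj_path d hd t ht) hc))

end RelayNetwork

end CoordinationGame

/-! ### An open chain of cycles as a network of hubs. -/

namespace OpenChainOfCycles

variable {V : Type*} {G : Digraph V} {m : ℕ} {len : Fin m → ℕ} (P : OpenChainOfCycles G len)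
  (hm : 2 ≤ m)

include P in
theorem neZero (j : Fin m) : NeZero (len j) := ⟨by have := P.three_le_len j; omega⟩

/-- The position `p` of the `j`-th cycle belongs to no other cycle. -/
def Inner (j : Fin m) (p : ZMod (len j)) : Prop :=
  ((j : ℕ) ≠ 0 → p ≠ P.attach j) ∧ ((j : ℕ) + 1 < m → p ≠ 0)

variable {P}

theorem Inner.cycle_eq {j j' : Fin m} {p : ZMod (len j)} {p' : ZMod (len j')} (h : P.Inner j p)
    (he : P.node j p = P.node j' p') : j = j' := by
  rcases lt_trichotomy j j' with hlt | heq | hlt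
  · obtain ⟨h1, h2, -⟩ := (P.node_eq_node_iff j j' hlt p p').1 he
    exact absurd h2 (h.2 (by omega))
  · exact heq
  · obtain ⟨h1, -, h2⟩ := (P.node_eq_node_iff j' j hlt p' p).1 he.symm
    exact absurd h2 (h.1 (by omega))

theorem Inner.adj_iff {j : Fin m} {p : ZMod (len j)} (h : P.Inner j p) (u : V) :
    G.Adj u (P.node j p) ↔ u = P.node j (p - 1) := by
  rw [P.adj_iff]
  constructor
  · rintro ⟨j', i, rfl, he⟩
    obtain rfl := h.cycle_eq he
    rw [P.node_injective j he, add_sub_cancel_right]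
  · rintro rfl
    exact ⟨j, p - 1, rfl, by rw [sub_add_cancel]⟩

theorem Inner.ne_node_zero {j i : Fin m} {p : ZMod (len j)} (h : P.Inner j p)
    (hi : (i : ℕ) + 1 < m) : P.node j p ≠ P.node i 0 := by
  intro he
  obtain rfl := h.cycle_eq he
  exact h.2 hi (P.node_injective j he)

variable (P)

theorem adj_node_zero_iff {j j' : Fin m} (hj : (j : ℕ) + 1 = j') (u : V) :
    G.Adj u (P.node j 0) ↔ u = P.node j (-1) ∨ u = P.node j' (P.attach j' - 1) := by
  have hlt : j < j' := Fin.lt_def.2 (by omega)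
  rw [P.adj_iff]
  constructor
  · rintro ⟨w, i, rfl, he⟩
    rcases lt_trichotomy j w with hjw | rfl | hjw
    · obtain ⟨h1, -, h2⟩ := (P.node_eq_node_iff j w hjw _ _).1 he
      obtain rfl : w = j' := Fin.ext (by omega)
      exact .inr (by rw [← h2, add_sub_cancel_right])
    · refine .inl ?_
      rw [eq_neg_of_add_eq_zero_left (P.node_injective j he).symm]
    · obtain ⟨-, -, h2⟩ := (P.node_eq_node_iff w j hjw _ _).1 he.symm
      exact absurd h2.symm (P.attach_ne_zero j)
  · rintro (rfl | rfl)
    · exact ⟨j, -1, rfl, by rw [neg_add_cancel]⟩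
    · exact ⟨j', _, rfl, by rw [sub_add_cancel, P.node_eq_node_iff j j' hlt]; exact ⟨hj, rfl, rfl⟩⟩

theorem node_attach {j j' : Fin m} (hj : (j : ℕ) + 1 = j') :
    P.node j' (P.attach j') = P.node j 0 :=
  ((P.node_eq_node_iff j j' (Fin.lt_def.2 (by omega)) _ _).2 ⟨hj, rfl, rfl⟩).symm

/-- The `i`-th cycle, or the last one. -/
def cyc (i : ℕ) : Fin m := ⟨min i (m - 1), by omega⟩

/-- The cycle that contains a path. -/
def pathCycle (d : Bool × ℕ) : Fin m := cyc hm (if d.1 then d.2 + 1 else d.2)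

/-- The position at which a path starts. -/
def start (d : Bool × ℕ) : ZMod (len (pathCycle hm d)) :=
  -- In a middle cycle, position `0` is the right hub and the attachment point the left one. The
  -- first cycle has only the hub at `0` and the last only that at its attachment point, and their
  -- single paths go all the way round.
  if (if d.1 then d.2 + 1 < m - 1 else d.2 = 0) then 0 else P.attach _

/-- The length of a path. -/
def pathLen (d : Bool × ℕ) : ℕ :=
  if d.1 then if d.2 + 1 < m - 1 then (P.attach (pathCycle hm d)).val - 1
    else len (pathCycle hm d) - 1
  else len (pathCycle hm d) - 1 - (P.start hm d).val

theorem pathLen_lt (d : Bool × ℕ) : P.pathLen hm d < len (pathCycle hm d) := by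
  have h3 := P.three_le_len (pathCycle hm d)
  have := P.neZero (pathCycle hm d)
  have h1 := ZMod.val_lt (P.attach (pathCycle hm d))
  unfold pathLen
  split_ifs <;> omega

variable {hm}

theorem cyc_val {i : ℕ} (hi : i < m) : (cyc hm i : ℕ) = i := by simp [cyc]; omega

theorem start_add_val_false {i t : ℕ} (ht : t ≤ P.pathLen hm (false, i)) :
    (P.start hm (false, i) + (t : ZMod _)).val = (P.start hm (false, i)).val + t := by
  have h3 := P.three_le_len (pathCycle hm (false, i))
  have := P.neZero (pathCycle hm (false, i))
  simp only [pathLen, Bool.false_eq_true, if_false] at ht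
  have h1 := ZMod.val_lt (P.start hm (false, i))
  have h2 : ((t : ZMod (len (pathCycle hm (false, i))))).val = t :=
    ZMod.val_natCast_of_lt (by omega)
  rw [ZMod.val_add_of_lt (by rw [h2]; omega), h2]

theorem start_add_val_true {i t : ℕ} (hi : i + 1 < m - 1) (ht : t ≤ P.pathLen hm (true, i)) :
    (P.start hm (true, i) + (t : ZMod _)).val = t := by
  have := P.pathLen_lt hm (true, i)
  simp only [start, if_true, hi, zero_add]
  exact ZMod.val_natCast_of_lt (by omega)

theorem inner_start_add {d : Bool × ℕ} (hd : d.2 < m - 1) {t : ℕ} (ht : t < P.pathLen hm d) :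
    P.Inner (pathCycle hm d) (P.start hm d + (t + 1 : ℕ)) := by
  have := P.neZero (pathCycle hm d)
  have hlen := P.pathLen_lt hm d
  have hcast : ((t + 1 : ℕ) : ZMod (len (pathCycle hm d))) ≠ 0 := fun h => by
    have h' := congrArg ZMod.val h
    rw [ZMod.val_natCast_of_lt (by omega), ZMod.val_zero] at h'
    omega
  obtain ⟨_ | _, i⟩ := d
  · have hv := P.start_add_val_false (t := t + 1) ht
    refine ⟨fun hj h => ?_, fun _ h => ?_⟩
    · have hi : i ≠ 0 := by rintro rfl; exact hj (cyc_val (i := 0) (by omega))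
      have hs : P.start hm (false, i) = P.attach _ := by simp [start, hi]
      rw [hs] at h
      exact hcast (left_eq_add.1 h.symm)
    · rw [h, ZMod.val_zero] at hv
      omega
  · have hc : (pathCycle hm (true, i) : ℕ) = i + 1 := cyc_val (i := i + 1) (by simp at hd; omega)
    by_cases hi : i + 1 < m - 1
    · have hv := P.start_add_val_true hi (t := t + 1) ht
      simp only [pathLen, if_true, hi] at ht
      refine ⟨fun _ h => ?_, fun _ h => ?_⟩
      · rw [h] at hv
        omega
      · rw [h, ZMod.val_zero] at hv
        omega
    · refine ⟨fun _ h => ?_, fun h => by omega⟩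
      have hs : P.start hm (true, i) = P.attach _ := by simp [start, hi]
      rw [hs] at h
      exact hcast (left_eq_add.1 h.symm)

theorem start_add_pathLen_false (i : ℕ) :
    P.start hm (false, i) + (P.pathLen hm (false, i) : ZMod _) = -1 := by
  have h3 := P.three_le_len (pathCycle hm (false, i))
  have := P.neZero (pathCycle hm (false, i))
  have h1 := ZMod.val_lt (P.start hm (false, i))
  have h2 : (P.start hm (false, i)).val + P.pathLen hm (false, i) + 1 =
      len (pathCycle hm (false, i)) := by
    simp only [pathLen, Bool.false_eq_true, if_false]
    omega
  have h4 := congrArg (Nat.cast : ℕ → ZMod (len (pathCycle hm (false, i)))) h2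
  rw [Nat.cast_add, Nat.cast_add, ZMod.natCast_zmod_val, ZMod.natCast_self, Nat.cast_one] at h4
  exact eq_neg_of_add_eq_zero_left h4

theorem start_add_pathLen_true (i : ℕ) :
    P.start hm (true, i) + (P.pathLen hm (true, i) : ZMod _) = P.attach _ - 1 := by
  have h3 := P.three_le_len (pathCycle hm (true, i))
  have := P.neZero (pathCycle hm (true, i))
  by_cases hi : i + 1 < m - 1
  · have h0 : 0 < (P.attach (pathCycle hm (true, i))).val :=
      Nat.pos_of_ne_zero fun h => P.attach_ne_zero _ ((ZMod.val_eq_zero _).1 h)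
    simp only [start, pathLen, if_true, hi, zero_add]
    rw [Nat.cast_sub h0, ZMod.natCast_zmod_val, Nat.cast_one]
  · simp only [start, pathLen, if_true, hi, if_false]
    rw [Nat.cast_sub (by omega), ZMod.natCast_self, Nat.cast_one, zero_sub, sub_eq_add_neg]

/-- In a middle cycle the attachment point separates the two paths: positions below it lie on the
path to the left hub, positions above it on the path to the right hub. -/
theorem exists_path_of_inner {j : Fin m} {p : ZMod (len j)} (h : P.Inner j p) :
    ∃ d : Bool × ℕ, d.2 < m - 1 ∧ ∃ t < P.pathLen hm d,
      P.node j p = P.node (pathCycle hm d) (P.start hm d + (t + 1 : ℕ)) := by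
  obtain ⟨i, hi, rfl⟩ : ∃ i < m, cyc hm i = j := ⟨j, j.2, Fin.ext (cyc_val j.2)⟩
  obtain ⟨h1, h2⟩ := h
  rw [cyc_val hi] at h1 h2
  have := P.neZero (cyc hm i)
  have hlt := ZMod.val_lt p
  have hne : ∀ q : ZMod (len (cyc hm i)), p ≠ q → (p - q).val ≠ 0 := fun q hq h =>
    hq (sub_eq_zero.1 ((ZMod.val_eq_zero _).1 h))
  have key : ∀ q : ZMod (len (cyc hm i)), ∀ t : ℕ, t + 1 = (p - q).val →
      p = q + ((t + 1 : ℕ) : ZMod (len (cyc hm i))) := fun q t ht => by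
    rw [ht, ZMod.natCast_zmod_val, add_sub_cancel]
  obtain rfl | ⟨i, rfl⟩ : i = 0 ∨ ∃ i', i = i' + 1 := by
    cases i <;> simp
  · have h0 := hne 0 (h2 (by omega))
    have hs : P.start hm (false, 0) = 0 := by simp [start]
    refine ⟨(false, 0), by simp; omega, (p - 0).val - 1, ?_, ?_⟩
    · simp only [pathLen, Bool.false_eq_true, if_false]
      rw [hs, ZMod.val_zero]
      change _ < len (cyc hm 0) - 1 - 0
      rw [sub_zero] at *
      omega
    · exact congrArg (P.node (cyc hm 0)) (by rw [hs]; exact key 0 _ (by omega))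
  by_cases hi' : i + 1 < m - 1
  · have h0 := hne 0 (h2 (by omega))
    have ha : p.val ≠ (P.attach (cyc hm (i + 1))).val := fun h =>
      h1 (by omega) (ZMod.val_injective _ h)
    rcases lt_or_gt_of_ne ha with hp | hp
    · have hs : P.start hm (true, i) = 0 := by simp [start, hi']
      refine ⟨(true, i), by simp; omega, (p - 0).val - 1, ?_, ?_⟩
      · simp only [pathLen, if_true, hi']
        change _ < (P.attach (cyc hm (i + 1))).val - 1
        rw [sub_zero] at *
        omega
      · exact congrArg (P.node (cyc hm (i + 1))) (by rw [hs]; exact key 0 _ (by omega))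
    · have hs : P.start hm (false, i + 1) = P.attach _ := by simp [start]
      have hv : (p - P.attach (cyc hm (i + 1))).val = p.val - (P.attach (cyc hm (i + 1))).val :=
        ZMod.val_sub hp.le
      refine ⟨(false, i + 1), by simp; omega, (p - P.attach (cyc hm (i + 1))).val - 1, ?_, ?_⟩
      · simp only [pathLen, Bool.false_eq_true, if_false]
        rw [hs]
        change _ < len (cyc hm (i + 1)) - 1 - (P.attach (cyc hm (i + 1))).val
        omega
      · exact congrArg (P.node (cyc hm (i + 1))) (by
          rw [hs]
          exact key (P.attach (cyc hm (i + 1))) _ (Nat.sub_add_cancel (by omega)))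
  · have ha := hne _ (h1 (by omega))
    have hs : P.start hm (true, i) = P.attach _ := by simp [start, hi']
    have hv := ZMod.val_lt (p - P.attach (cyc hm (i + 1)))
    refine ⟨(true, i), by simp; omega, (p - P.attach (cyc hm (i + 1))).val - 1, ?_, ?_⟩
    · simp only [pathLen, if_true, hi', if_false]
      change _ < len (cyc hm (i + 1)) - 1
      omega
    · exact congrArg (P.node (cyc hm (i + 1))) (by
        rw [hs]
        exact key (P.attach (cyc hm (i + 1))) _ (Nat.sub_add_cancel (by omega)))

end OpenChainOfCycles

open OpenChainOfCycles in
/-- The nodes that an open chain of cycles shares between cycles are the hubs of a network. -/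
noncomputable def CoordinationGame.networkOfChain {V M : Type*} {𝒢 : CoordinationGame V M} {m : ℕ}
    {len : Fin m → ℕ} (P : OpenChainOfCycles 𝒢.graph len) (hm : 2 ≤ m) : 𝒢.RelayNetwork where
  k := m - 1
  pos := by omega
  hub i := P.node (cyc hm i) 0
  path d t := P.node (pathCycle hm d) (P.start hm d + (t : ℕ))
  len := P.pathLen hm
  path_zero_false i hi := by
    rw [Nat.cast_zero, add_zero]
    obtain _ | i := i
    · simp [start, pathCycle]
      rfl
    · have hs : P.start hm (false, i + 1) = P.attach _ := by simp [start]
      rw [hs]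
      refine P.node_attach ?_
      rw [cyc_val (by omega)]
      exact (cyc_val (by omega)).symm
  path_zero_true i hi := by
    rw [Nat.cast_zero, add_zero]
    by_cases hi' : i + 1 < m - 1
    · have hs : P.start hm (true, i) = 0 := by simp [start, hi']
      rw [hs, min_eq_left (by omega)]
      rfl
    · have hs : P.start hm (true, i) = P.attach _ := by simp [start, hi']
      rw [hs, min_eq_right (by omega)]
      refine P.node_attach ?_
      rw [cyc_val (by omega)]
      refine Eq.trans ?_ (cyc_val (i := i + 1) (by omega)).symm
      omega
  len_pos_false := by
    have := P.three_le_len (pathCycle hm (false, 0))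
    simp [pathLen, start]
    omega
  len_pos_true := by
    have := P.three_le_len (pathCycle hm (true, m - 1 - 1))
    have h : ¬ m - 1 - 1 + 1 < m - 1 := by omega
    simp only [pathLen, if_true, h, if_false]
    omega
  adj_path d hd t ht u := by
    rw [(P.inner_start_add hd ht).adj_iff, Nat.cast_succ, ← add_assoc, add_sub_cancel_right]
  adj_hub i hi u := by
    rw [P.start_add_pathLen_false, P.start_add_pathLen_true]
    refine P.adj_node_zero_iff ?_ u
    rw [cyc_val (by omega)]
    exact (cyc_val (by omega)).symm
  ends_ne i hi := by
    rw [P.start_add_pathLen_false, P.start_add_pathLen_true]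
    have h1 : (pathCycle hm (false, i) : ℕ) = i := cyc_val (i := i) (by omega)
    have h2 : (pathCycle hm (true, i) : ℕ) = i + 1 := cyc_val (i := i + 1) (by omega)
    intro h
    have h3 := ((P.node_eq_node_iff _ _ (Fin.lt_def.2 (by omega)) _ _).1 h).2.1
    have := P.three_le_len (pathCycle hm (false, i))
    have : Fact (1 < len (pathCycle hm (false, i))) := ⟨by omega⟩
    exact neg_ne_zero.2 one_ne_zero h3
  hub_inj i hi j hj h := by
    rcases lt_trichotomy (cyc hm i) (cyc hm j) with hlt | heq | hlt
    · exact absurd ((P.node_eq_node_iff _ _ hlt _ _).1 h).2.2.symm (P.attach_ne_zero _)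
    · have := congrArg Fin.val heq
      rwa [cyc_val (by omega), cyc_val (by omega)] at this
    · exact absurd ((P.node_eq_node_iff _ _ hlt _ _).1 h.symm).2.2.symm (P.attach_ne_zero _)
  path_ne_hub d hd t ht j hj :=
    (P.inner_start_add hd ht).ne_node_zero (by rw [cyc_val (by omega)]; omega)
  path_inj d hd t ht d' hd' t' ht' h := by
    have hc := congrArg Fin.val ((P.inner_start_add hd ht).cycle_eq h)
    -- The two paths of a middle cycle lie on opposite sides of the attachment point.
    have hmix : ∀ i t t' : ℕ, i + 1 < m - 1 → t < P.pathLen hm (false, i + 1) →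
        t' < P.pathLen hm (true, i) →
        P.node (pathCycle hm (false, i + 1)) (P.start hm (false, i + 1) + (t + 1 : ℕ)) ≠
        P.node (pathCycle hm (true, i)) (P.start hm (true, i) + (t' + 1 : ℕ)) := by
      intro i t t' hi ht ht' h
      have hv := congrArg ZMod.val (P.node_injective _ h)
      have hs : P.start hm (false, i + 1) = P.attach (pathCycle hm (true, i)) := by
        simp only [start]
        simp
        rfl
      refine absurd ((P.start_add_val_false (t := t + 1) ht).symm.trans
        (hv.trans (P.start_add_val_true hi (t := t' + 1) ht'))) ?_
      rw [hs]
      simp only [pathLen, if_true, hi] at ht'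
      change (P.attach (pathCycle hm (true, i))).val + _ ≠ _
      omega
    have hdd : d = d' := by
      obtain ⟨_ | _, i⟩ := d <;> obtain ⟨_ | _, i'⟩ := d' <;>
        simp only [pathCycle, Bool.false_eq_true, if_false, if_true] at hc hd hd' <;>
        rw [cyc_val (by omega), cyc_val (by omega)] at hc
      · rw [hc]
      · subst hc
        exact absurd h (hmix i' t t' hd ht ht')
      · subst hc
        exact absurd h.symm (hmix i t' t hd' ht' ht)
      · rw [Nat.succ_injective hc]
    subst hdd
    have hlen := P.pathLen_lt hm d
    have he := congrArg ZMod.val (add_left_cancel (P.node_injective _ h))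
    rw [ZMod.val_natCast_of_lt (by omega), ZMod.val_natCast_of_lt (by omega)] at he
    exact ⟨rfl, by omega⟩
  exhaust v := by
    obtain ⟨j, p, rfl⟩ := P.exists_node v
    by_cases h : P.Inner j p
    · exact .inr (P.exists_path_of_inner h)
    refine .inl ?_
    simp only [OpenChainOfCycles.Inner, not_and_or, not_forall, not_not] at h
    rcases h with ⟨h1, h2⟩ | ⟨h1, h2⟩
    · refine ⟨j - 1, by omega, ?_⟩
      rw [h2]
      refine P.node_attach ?_
      rw [cyc_val (by omega)]
      omega
    · refine ⟨j, by omega, ?_⟩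
      have : cyc hm j = j := Fin.ext (cyc_val j.2)
      rw [h2, this]

/-! ### From bounded reachability to a finite improvement path. -/

theorem ReachIn.exists_path {S : Type*} {R : S → S → Prop} {n : ℕ} {s t : S}
    (h : ReachIn R n s t) :
    ∃ ρ : List S, ρ.IsChain R ∧ ρ.head? = some s ∧ ρ.getLast? = some t ∧ ρ.length ≤ n + 1 := by
  induction h with
  | refl n s => exact ⟨[s], by simp, rfl, rfl, by simp⟩
  | step hst _ ih =>
    obtain ⟨ρ, h1, h2, h3, h4⟩ := ih
    obtain _ | ⟨u, ρ⟩ := ρ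
    · simp at h2
    · obtain rfl : u = _ := by simpa using h2
      refine ⟨_ :: u :: ρ, List.isChain_cons_cons.2 ⟨hst, h1⟩, rfl, ?_, by simpa using h4⟩
      rw [List.getLast?_cons_cons, h3]

theorem mainTheorem5 :
    ∃ K : ℕ, ∀ (V M : Type*) [Fintype V] [Finite M] (𝒢 : CoordinationGame V M)
      (m n : ℕ) (len : Fin m → ℕ), 2 ≤ m → (∀ j, len j ≤ n) →
      OpenChainOfCycles 𝒢.graph len →
      ∀ s₀ : 𝒢.toStrategicGame.Joint,
        ∃ ρ : List 𝒢.toStrategicGame.Joint,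
          𝒢.toStrategicGame.IsFiniteImprovementPath ρ ∧ ρ.head? = some s₀ ∧
          ρ.length ≤ K * (n * m ^ 3) := by
  refine ⟨24, fun V M _ _ 𝒢 m n len hm hlen P s₀ => ?_⟩
  have hn : ∀ d, d.2 < (CoordinationGame.networkOfChain P hm).k →
      (CoordinationGame.networkOfChain P hm).len d ≤ n := fun d _ =>
    (P.pathLen_lt hm d).le.trans (hlen _)
  obtain ⟨s', reach, nash⟩ := CoordinationGame.RelayNetwork.exists_nash hn s₀
  obtain ⟨ρ, h1, h2, h3, h4⟩ := reach.exists_path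
  refine ⟨ρ, ⟨(by rintro rfl; cases h2), h1, fun s'' h => ?_⟩, h2, h4.trans ?_⟩
  · exact nash s'' ((List.isChain_append.1 h).2.2 s' h3 s'' rfl)
  · have hn3 : 3 ≤ n := (P.three_le_len ⟨0, by omega⟩).trans (hlen _)
    -- With `m - 1` hubs: the initial settling of all paths, the hub moves with their passes, the
    -- release of the two loops, and one for counting strategies instead of steps. The factor 24 is
    -- generous.
    change 2 * (m - 1) * n + 6 * (m - 1) * (m - 1) * (2 * n + 1) + 2 * n + 1 ≤ 24 * (n * m ^ 3)
    obtain ⟨k, rfl⟩ : ∃ k, m = k + 1 := ⟨m - 1, by omega⟩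
    rw [Nat.add_sub_cancel]
    have h5 : 6 * k * k * (2 * n + 1) ≤ 6 * k * k * (3 * n) := Nat.mul_le_mul_left _ (by omega)
    have h6 : 2 * k * n + 6 * k * k * (3 * n) + 3 * n ≤ 24 * (n * (k + 1) ^ 3) := by
      have : 2 * k + 18 * k * k + 3 ≤ 24 * (k + 1) ^ 3 := by
        ring_nf
        nlinarith [Nat.zero_le (k ^ 3), Nat.zero_le (k ^ 2), Nat.zero_le k]
      calc _ = n * (2 * k + 18 * k * k + 3) := by ring
        _ ≤ n * (24 * (k + 1) ^ 3) := Nat.mul_le_mul_left _ this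
        _ = _ := by ring
    omega
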